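/- All graphs are finite and simple and are considered up to isomorphism. For a vertex $x$ of a graph $G$ let $N[x]$ be the set consisting of $x$ and its neighbours. An identifying code of $G$ is a nonempty set $C\subseteq V(G)$ such that the sets $N[x]\cap C$, $x\in V(G)$, are nonempty and pairwise distinct; $\gamma^{\rm ID}(G)$ is the minimum cardinality of an identifying code of $G$ (if one exists). $G\,\square\,H$ is the Cartesian product and $G\bowtie H$ the join (the disjoint union together with all edges between $V(G)$ and $V(H)$). For $k\ge 1$ let $A_k$ be the graph on $\{x_1,\dots,x_{2k}\}$ in which distinct $x_i,x_j$ are adjacent iff $|i-j|\le k-1$, let $\mathcal A$ be the closure of $\{A_k: k\ge 1\}$ under $\bowtie$, and let $\mathcal A\bowtie K_1=\{H\bowtie K_1: H\in\mathcal A\}$. **Theorem 4.5.** (i) If $G\in\mathcal A\cup(\mathcal A\bowtie K_1)$ has order at least $5$, then $G$ and $G\,\square\,K_2$ have identifying codes and $$\gamma^{\rm ID}(G\,\square\,K_2)=\gamma^{\rm ID}(G).$$ (ii) For every integer $k\ge 4$ there is a graph $G\in\mathcal A\cup(\mathcal A\bowtie K_1)$ of order at least $5$ with $\gamma^{\rm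 ID}(G\,\square\,K_2)=\gamma^{\rm ID}(G)=k$. (iii) If $G_1,G_2\in\mathcal A\cup(\mathcal A\bowtie K_1)$ both have order at least $5$ (equivalently, neither is one of $A_1$, $A_2$, $A_1\bowtie A_1$, $A_1\bowtie K_1$), and $G_1\bowtie G_2\in\mathcal A\cup(\mathcal A\bowtie K_1)$, then $G_1\,\square\,K_2$, $G_2\,\square\,K_2$ and $(G_1\bowtie G_2)\,\square\,K_2$ have identifying codes and $$\gamma^{\rm ID}((G_1\bowtie G_2)\,\square\,K_2)=\gamma^{\rm ID}(G_1\,\square\,K_2)+\gamma^{\rm ID}(G_2\,\square\,K_2)+1.$$ -/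

import Mathlib

namespace IdentifyingCode

universe u v w

/-- The closed neighbourhood `N[x]`. -/
def closedNbhd {V : Type u} (G : SimpleGraph V) (x : V) : Set V :=
  {y | y = x ∨ G.Adj x y}

/-- The identifying set `I_C(x) = N[x] ∩ C`. -/
def idSet {V : Type u} (G : SimpleGraph V) (C : Finset V) (x : V) : Set V :=
  closedNbhd G x ∩ (C : Set V)

/-- `C` is an identifying code of `G`: a nonempty set of vertices that dominates `G` and
separates every pair of distinct vertices of `G`. -/
structure IsIDCode {V : Type u} (G : SimpleGraph V) (C : Finset V) : Prop where
  nonempty : C.Nonempty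
  dominates : ∀ x : V, (idSet G C x).Nonempty
  separates : ∀ x y : V, x ≠ y → idSet G C x ≠ idSet G C y

/-- `G` possesses an identifying code. -/
def HasIDCode {V : Type u} (G : SimpleGraph V) : Prop :=
  ∃ C : Finset V, IsIDCode G C

/-- The identifying code number: the least cardinality of an identifying code of `G`.
It is meaningful only when `HasIDCode G` holds. -/
noncomputable def idNumber {V : Type u} (G : SimpleGraph V) : ℕ :=
  sInf {n : ℕ | ∃ C : Finset V, IsIDCode G C ∧ C.card = n}

/-- The join of two graphs: their disjoint union together with all edges between the two
vertex sets. -/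
def join {V : Type u} {W : Type v} (G : SimpleGraph V) (H : SimpleGraph W) :
    SimpleGraph (V ⊕ W) :=
  (G ⊕g H) ⊔ completeBipartiteGraph V W

/-- The prism `G □ K₂`. -/
abbrev prism {V : Type u} (G : SimpleGraph V) : SimpleGraph (V × Fin 2) :=
  G □ SimpleGraph.completeGraph (Fin 2)

/-- The graph `A_k` on `2k` vertices, two distinct vertices being adjacent when their indices
differ by at most `k - 1`. -/
def graphA (k : ℕ) : SimpleGraph (Fin (2 * k)) where
  Adj i j := i ≠ j ∧ |((i : ℕ) : ℤ) - ((j : ℕ) : ℤ)| ≤ (k : ℤ) - 1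
  symm := ⟨fun i j h => ⟨h.1.symm, by rw [abs_sub_comm]; exact h.2⟩⟩
  loopless := ⟨fun _ h => h.1 rfl⟩

/-- The class `𝒜` (up to isomorphism): the closure of `{A_k : k ≥ 1}` under joins. -/
inductive ClassA : {V : Type u} → SimpleGraph V → Prop
  | base {V : Type u} (G : SimpleGraph V) (k : ℕ) (hk : 1 ≤ k)
      (e : Nonempty (G ≃g graphA k)) : ClassA G
  | join {V V₁ V₂ : Type u} (G : SimpleGraph V) (G₁ : SimpleGraph V₁) (G₂ : SimpleGraph V₂)
      (h₁ : ClassA G₁) (h₂ : ClassA G₂)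
      (e : Nonempty (G ≃g IdentifyingCode.join G₁ G₂)) : ClassA G

/-- The class `𝒜 ⋈ K₁` (up to isomorphism): all joins `H ⋈ K₁` with `H ∈ 𝒜`. -/
def ClassAK {V : Type u} (G : SimpleGraph V) : Prop :=
  ∃ (W : Type u) (H : SimpleGraph W), ClassA H ∧
    Nonempty (G ≃g join H (SimpleGraph.completeGraph (Fin 1)))

/-- The class `𝒜 ∪ (𝒜 ⋈ K₁)`. -/
def InClass {V : Type u} (G : SimpleGraph V) : Prop :=
  ClassA G ∨ ClassAK G

end IdentifyingCode

namespace IdentifyingCode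

universe u v w

/-! ### Closed neighbourhoods in joins, in `graphA` and in prisms; transport along isomorphisms. -/

section Basic

variable {V : Type u} {W : Type v} {G : SimpleGraph V} {H : SimpleGraph W}

/-! For a member of the class of order n ≥ 5, both identifying code numbers equal n - 1; all three
claims follow by arithmetic, with A_m and A_m ⋈ K₁ realising every order.

Lower bound (`HasCharge.card_le`): for any vertex set D, the proper traces N[x] ∩ D ≠ D can be
charged injectively to elements of D, so D separates at most |D| + 1 vertices. The property holds
for A_k, where each vertex misses a final or an initial segment, and it passes to joins. Applied to
a code of G it gives n - 1. In the prism, let D₀, D₁ be the layers of a code: the vertices (x, 0)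
with x ∉ D₁ must be separated by D₀ alone, so n - |D₁| ≤ |D₀| + 1.

Upper bound: some vertex v can be dropped from V without losing separation, so V minus v is a code
of G. For the prism, V minus v is split between the two layers; `exists_isIDCode_prism` gives
conditions under which the split works, and a split is chosen for each shape of G. -/

lemma mem_closedNbhd {x y : V} : y ∈ closedNbhd G x ↔ y = x ∨ G.Adj x y := Iff.rfl

lemma self_mem_closedNbhd (x : V) : x ∈ closedNbhd G x := Or.inl rfl

lemma mem_closedNbhd_iso (e : G ≃g H) {x y : V} :
    e y ∈ closedNbhd H (e x) ↔ y ∈ closedNbhd G x := by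
  simp [mem_closedNbhd, e.map_adj_iff]

@[simp] lemma join_adj_inl_inl {x y : V} :
    (join G H).Adj (Sum.inl x) (Sum.inl y) ↔ G.Adj x y := by
  simp [join]

@[simp] lemma join_adj_inr_inr {x y : W} :
    (join G H).Adj (Sum.inr x) (Sum.inr y) ↔ H.Adj x y := by
  simp [join]

@[simp] lemma join_adj_inl_inr {x : V} {y : W} :
    (join G H).Adj (Sum.inl x) (Sum.inr y) := by
  simp [join]

@[simp] lemma join_adj_inr_inl {x : V} {y : W} :
    (join G H).Adj (Sum.inr y) (Sum.inl x) := by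
  simp [join]

@[simp] lemma inl_mem_closedNbhd_join_inl {x y : V} :
    Sum.inl y ∈ closedNbhd (join G H) (Sum.inl x) ↔ y ∈ closedNbhd G x := by
  simp [mem_closedNbhd]

@[simp] lemma inr_mem_closedNbhd_join_inr {x y : W} :
    Sum.inr y ∈ closedNbhd (join G H) (Sum.inr x) ↔ y ∈ closedNbhd H x := by
  simp [mem_closedNbhd]

@[simp] lemma inr_mem_closedNbhd_join_inl {x : V} {y : W} :
    Sum.inr y ∈ closedNbhd (join G H) (Sum.inl x) := by
  simp [mem_closedNbhd]

@[simp] lemma inl_mem_closedNbhd_join_inr {x : V} {y : W} :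
    Sum.inl x ∈ closedNbhd (join G H) (Sum.inr y) := by
  simp [mem_closedNbhd]

lemma mem_closedNbhd_graphA {k : ℕ} {i j : Fin (2 * k)} :
    j ∈ closedNbhd (graphA k) i ↔ (i : ℕ) < j + k ∧ (j : ℕ) < i + k := by
  have hi := i.isLt
  simp only [mem_closedNbhd, graphA, abs_le, Fin.ext_iff, ne_eq]
  omega

lemma graphA_adj {k : ℕ} {i j : Fin (2 * k)} :
    (graphA k).Adj i j ↔ (i : ℕ) ≠ j ∧ (i : ℕ) < j + k ∧ (j : ℕ) < i + k := by
  simp only [graphA, abs_le, Fin.ext_iff, ne_eq]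
  omega

lemma mem_closedNbhd_prism_same {x y : V} {a : Fin 2} :
    (y, a) ∈ closedNbhd (prism G) (x, a) ↔ y ∈ closedNbhd G x := by
  simp [mem_closedNbhd, SimpleGraph.boxProd_adj]

lemma mem_closedNbhd_prism_ne {x y : V} {a b : Fin 2} (h : a ≠ b) :
    (y, b) ∈ closedNbhd (prism G) (x, a) ↔ y = x := by
  simp [mem_closedNbhd, SimpleGraph.boxProd_adj, h, eq_comm]

/-- The isomorphism of prisms induced by an isomorphism of graphs. -/
def prismIso (e : G ≃g H) : prism G ≃g prism H where
  toEquiv := e.toEquiv.prodCongr (Equiv.refl _)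
  map_rel_iff' := by
    rintro ⟨x, a⟩ ⟨y, b⟩
    simp [SimpleGraph.boxProd_adj, e.map_adj_iff]

lemma IsIDCode.map (e : G ≃g H) {C : Finset V} (hC : IsIDCode G C) :
    IsIDCode H (C.map e.toEquiv.toEmbedding) := by
  have key : ∀ x z, e z ∈ idSet H (C.map e.toEquiv.toEmbedding) (e x) ↔ z ∈ idSet G C x := by
    intro x z
    simp only [idSet, Set.mem_inter_iff, mem_closedNbhd_iso, Finset.mem_coe, Finset.mem_map]
    refine and_congr_right fun _ => ⟨?_, fun h => ⟨z, h, rfl⟩⟩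
    rintro ⟨w, hw, hwz⟩
    rwa [← e.injective hwz]
  refine ⟨by simpa using hC.nonempty, fun y => ?_, fun y y' hy h => ?_⟩
  · obtain ⟨x, rfl⟩ := e.surjective y
    obtain ⟨z, hz⟩ := hC.dominates x
    exact ⟨e z, (key x z).2 hz⟩
  · obtain ⟨x, rfl⟩ := e.surjective y
    obtain ⟨x', rfl⟩ := e.surjective y'
    refine hC.separates x x' (fun hxx => hy (by rw [hxx])) (Set.ext fun z => ?_)
    rw [← key, ← key, h]

lemma exists_isIDCode_of_iso (e : G ≃g H) {n : ℕ} (h : ∃ C, IsIDCode H C ∧ C.card = n) :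
    ∃ C, IsIDCode G C ∧ C.card = n := by
  obtain ⟨C, hC, hn⟩ := h
  exact ⟨_, hC.map e.symm, by rw [Finset.card_map, hn]⟩

lemma idNumber_eq {n : ℕ} (h : ∃ C, IsIDCode G C ∧ C.card = n)
    (hle : ∀ C, IsIDCode G C → n ≤ C.card) : idNumber G = n := by
  refine le_antisymm (Nat.sInf_le h) (le_csInf ⟨n, h⟩ ?_)
  rintro m ⟨C, hC, rfl⟩
  exact hle C hC

end Basic

/-! ### Lower bound by charging traces to code vertices. -/

section LowerBound

/-- For every set `D`, the distinct traces on `D` of the closed neighbourhoods that do not contain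
`D` can be charged to distinct elements of `D`. -/
def HasCharge {V : Type u} (G : SimpleGraph V) : Prop :=
  ∀ D : Set V, ∃ m : V → V, ∀ x, ¬ D ⊆ closedNbhd G x → m x ∈ D ∧
    ∀ y, ¬ D ⊆ closedNbhd G y → m x = m y → closedNbhd G x ∩ D = closedNbhd G y ∩ D

variable {V : Type u} {W : Type v} {G : SimpleGraph V} {H : SimpleGraph W}

lemma HasCharge.of_iso (e : G ≃g H) (h : HasCharge H) : HasCharge G := by
  intro D
  obtain ⟨m, hm⟩ := h (e '' D)
  have hsub : ∀ x, e '' D ⊆ closedNbhd H (e x) ↔ D ⊆ closedNbhd G x := by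
    intro x
    rw [Set.image_subset_iff]
    exact forall₂_congr fun z _ => mem_closedNbhd_iso e
  refine ⟨fun x => e.symm (m (e x)), fun x hx => ?_⟩
  obtain ⟨⟨z, hz, hzm⟩, h2⟩ := hm (e x) (by rwa [hsub])
  refine ⟨by simpa [← hzm] using hz, fun y hy hxy => ?_⟩
  have h3 := h2 (e y) (by rwa [hsub]) (e.symm.injective hxy)
  ext w
  have h4 := Set.ext_iff.1 h3 (e w)
  simpa [mem_closedNbhd_iso] using h4

/-- A vertex of a join can miss elements of D only on its own side, so the charges of the two sides
never meet. -/
lemma HasCharge.join (hG : HasCharge G) (hH : HasCharge H) : HasCharge (join G H) := by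
  intro D
  obtain ⟨m, hm⟩ := hG (Sum.inl ⁻¹' D)
  obtain ⟨m', hm'⟩ := hH (Sum.inr ⁻¹' D)
  have hl : ∀ x, ¬ D ⊆ closedNbhd (IdentifyingCode.join G H) (Sum.inl x) →
      ¬ Sum.inl ⁻¹' D ⊆ closedNbhd G x := by
    intro x hx h
    refine hx ?_
    rintro (z | z) hz
    · simpa using h hz
    · simp
  have hr : ∀ x, ¬ D ⊆ closedNbhd (IdentifyingCode.join G H) (Sum.inr x) →
      ¬ Sum.inr ⁻¹' D ⊆ closedNbhd H x := by
    intro x hx h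
    refine hx ?_
    rintro (z | z) hz
    · simp
    · simpa using h hz
  refine ⟨Sum.map m m', ?_⟩
  rintro (x | x) hx
  · refine ⟨(hm x (hl x hx)).1, ?_⟩
    rintro (y | y) hy hxy
    · have h := (hm x (hl x hx)).2 y (hl y hy) (Sum.inl_injective hxy)
      ext (z | z)
      · simpa using Set.ext_iff.1 h z
      · simp
    · simp at hxy
  · refine ⟨(hm' x (hr x hx)).1, ?_⟩
    rintro (y | y) hy hxy
    · simp at hxy
    · have h := (hm' x (hr x hx)).2 y (hr y hy) (Sum.inr_injective hxy)
      ext (z | z)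
      · simp
      · simpa using Set.ext_iff.1 h z

lemma hasCharge_complete_one : HasCharge (SimpleGraph.completeGraph (Fin 1)) := by
  refine fun D => ⟨id, fun x hx => (hx fun z _ => ?_).elim⟩
  rw [Subsingleton.elim z x]
  exact self_mem_closedNbhd x

/-- A vertex x < k misses exactly the indices ≥ x + k, and a vertex x ≥ k exactly those ≤ x - k. The
trace is thus fixed by the missed element of D nearest the middle, and x is charged to that element.
-/
lemma hasCharge_graphA (k : ℕ) : HasCharge (graphA k) := by
  classical
  intro D
  have key : ∀ x : Fin (2 * k), ∃ a : Fin (2 * k), ¬ D ⊆ closedNbhd (graphA k) x →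
      a ∈ D ∧ a ∉ closedNbhd (graphA k) x ∧
      ∀ z ∈ D, z ∉ closedNbhd (graphA k) x → if (x : ℕ) < k then a ≤ z else z ≤ a := by
    intro x
    by_cases h : D ⊆ closedNbhd (graphA k) x
    · exact ⟨x, fun h' => (h' h).elim⟩
    let s : Finset (Fin (2 * k)) :=
      Finset.univ.filter fun z => z ∈ D ∧ z ∉ closedNbhd (graphA k) x
    have hs : s.Nonempty := by
      obtain ⟨z, hz, hz'⟩ := Set.not_subset.1 h
      exact ⟨z, by simp [s, hz, hz']⟩
    by_cases hx : (x : ℕ) < k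
    · have hmem := s.min'_mem hs
      simp only [s, Finset.mem_filter, Finset.mem_univ, true_and] at hmem
      refine ⟨s.min' hs, fun _ => ⟨hmem.1, hmem.2, fun z hz hz' => ?_⟩⟩
      rw [if_pos hx]
      exact s.min'_le z (by simp [s, hz, hz'])
    · have hmem := s.max'_mem hs
      simp only [s, Finset.mem_filter, Finset.mem_univ, true_and] at hmem
      refine ⟨s.max' hs, fun _ => ⟨hmem.1, hmem.2, fun z hz hz' => ?_⟩⟩
      rw [if_neg hx]
      exact s.le_max' z (by simp [s, hz, hz'])
  choose m hm using key
  refine ⟨m, fun x hx => ⟨(hm x hx).1, fun y hy hxy => ?_⟩⟩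
  obtain ⟨-, hx2, hx3⟩ := hm x hx
  obtain ⟨-, hy2, hy3⟩ := hm y hy
  rw [← hxy] at hy2 hy3
  ext z
  simp only [Set.mem_inter_iff, and_congr_left_iff]
  intro hz
  have h1 := hx3 z hz
  have h2 := hy3 z hz
  simp only [mem_closedNbhd_graphA, Fin.le_def] at *
  have := x.isLt
  have := y.isLt
  have := z.isLt
  have := (m x).isLt
  -- For x and y in opposite halves the common charge would be both ≥ k and < k; in the same half it
  -- is the same cut-off for both.
  split_ifs at h1 h2 <;> omega

lemma ClassA.hasCharge {G : SimpleGraph V} (h : ClassA G) : HasCharge G := by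
  induction h with
  | base G k hk e => exact (hasCharge_graphA k).of_iso e.some
  | join G G₁ G₂ _ _ e ih₁ ih₂ => exact (ih₁.join ih₂).of_iso e.some

lemma InClass.hasCharge {G : SimpleGraph V} (h : InClass G) : HasCharge G := by
  rcases h with h | ⟨W, H, hH, ⟨e⟩⟩
  · exact h.hasCharge
  · exact (hH.hasCharge.join hasCharge_complete_one).of_iso e

/-- The extra 1 counts the single vertex of S whose trace may be all of D. -/
lemma HasCharge.card_le (hG : HasCharge G) (S D : Finset V)
    (h : Set.InjOn (fun x => closedNbhd G x ∩ (D : Set V)) S) : S.card ≤ D.card + 1 := by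
  classical
  obtain ⟨m, hm⟩ := hG D
  rw [← Finset.card_filter_add_card_filter_not (s := S)
    (fun x => (D : Set V) ⊆ closedNbhd G x), add_comm]
  refine add_le_add (Finset.card_le_card_of_injOn m ?_ ?_) (Finset.card_le_one.2 ?_)
  · intro x hx
    exact (hm x (Finset.mem_filter.1 hx).2).1
  · intro x hx y hy hxy
    have hx' := Finset.mem_filter.1 hx
    have hy' := Finset.mem_filter.1 hy
    exact h hx'.1 hy'.1 ((hm x hx'.2).2 y hy'.2 hxy)
  · intro x hx y hy
    have hx' := Finset.mem_filter.1 hx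
    have hy' := Finset.mem_filter.1 hy
    refine h hx'.1 hy'.1 ?_
    simp only [Set.inter_eq_right.2 hx'.2, Set.inter_eq_right.2 hy'.2]

lemma HasCharge.le_card_of_isIDCode [Finite V] (hG : HasCharge G) {C : Finset V}
    (hC : IsIDCode G C) : Nat.card V - 1 ≤ C.card := by
  have := Fintype.ofFinite V
  have h := hG.card_le Finset.univ C fun x _ y _ hxy => by
    by_contra hne
    exact hC.separates x y hne hxy
  rw [Finset.card_univ, ← Nat.card_eq_fintype_card] at h
  omega

lemma HasCharge.le_card_of_isIDCode_prism [Finite V] (hG : HasCharge G)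
    {C : Finset (V × Fin 2)} (hC : IsIDCode (prism G) C) : Nat.card V - 1 ≤ C.card := by
  classical
  have := Fintype.ofFinite V
  let D : Fin 2 → Finset V := fun a => Finset.univ.filter fun x => (x, a) ∈ C
  have hcard : (D 0).card + (D 1).card ≤ C.card := by
    rw [← Finset.card_filter_add_card_filter_not (s := C) (fun p => p.2 = 0)]
    refine add_le_add (Finset.card_le_card_of_injOn (fun x => (x, 0)) ?_ ?_)
      (Finset.card_le_card_of_injOn (fun x => (x, 1)) ?_ ?_)
    · intro x hx
      simpa [D] using hx
    · intro x _ y _ hxy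
      simpa using hxy
    · intro x hx
      simpa [D] using hx
    · intro x _ y _ hxy
      simpa using hxy
  -- For x ∉ D 1 the vertex (x, 0) sees no code vertex in layer 1, so `D 0` alone must separate
  -- these vertices.
  have h := hG.card_le (D 1)ᶜ (D 0) fun x hx y hy hxy => by
    by_contra hne
    have hx' : (x, (1 : Fin 2)) ∉ C := by simpa [D] using hx
    have hy' : (y, (1 : Fin 2)) ∉ C := by simpa [D] using hy
    refine hC.separates (x, 0) (y, 0) (by simpa using hne) ?_
    ext ⟨z, a⟩
    have hz := Set.ext_iff.1 hxy z
    obtain rfl | rfl : a = 0 ∨ a = 1 := by omega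
    · simpa [idSet, mem_closedNbhd_prism_same, D] using hz
    · simp only [idSet, Set.mem_inter_iff, mem_closedNbhd_prism_ne (zero_ne_one' (Fin 2)),
        Finset.mem_coe]
      constructor
      · rintro ⟨rfl, h⟩
        exact (hx' h).elim
      · rintro ⟨rfl, h⟩
        exact (hy' h).elim
  rw [Finset.card_compl, ← Nat.card_eq_fintype_card] at h
  omega

end LowerBound

/-! ### Upper bound: codes omitting one vertex. -/

section UpperBound

variable {V : Type u} {W : Type v} {G : SimpleGraph V} {H : SimpleGraph W}

/-- `v` is superfluous when the remaining vertices still separate all vertices of `G`. -/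
def Superfluous (G : SimpleGraph V) (v : V) : Prop :=
  ∀ x y, (∀ z, z ≠ v → (z ∈ closedNbhd G x ↔ z ∈ closedNbhd G y)) → x = y

lemma Superfluous.exists_isIDCode [Finite V] {v : V} (h : Superfluous G v)
    (hv : ∃ z, G.Adj v z) : ∃ C, IsIDCode G C ∧ C.card = Nat.card V - 1 := by
  classical
  have := Fintype.ofFinite V
  obtain ⟨z, hz⟩ := hv
  refine ⟨{v}ᶜ, ⟨⟨z, by simpa using hz.ne'⟩, fun x => ?_, fun x y hxy he => hxy (h x y ?_)⟩, ?_⟩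
  · by_cases hx : x = v
    · subst hx
      exact ⟨z, Or.inr hz, by simpa using hz.ne'⟩
    · exact ⟨x, Or.inl rfl, by simpa using hx⟩
  · intro w hw
    simpa [idSet, hw] using Set.ext_iff.1 he w
  · rw [Finset.card_compl, Finset.card_singleton, Nat.card_eq_fintype_card]

/-- The vertices other than `v`, those in `B` taken in layer `1` and the others in layer `0`,
form an identifying code of the prism. -/
lemma exists_isIDCode_prism [Finite V] (B : Set V) (v : V) (hvB : v ∉ B)
    (hsep₀ : ∀ x y, x ∉ B → y ∉ B →
      (∀ z, z ∉ B → z ≠ v → (z ∈ closedNbhd G x ↔ z ∈ closedNbhd G y)) → x = y)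
    (hsep₁ : ∀ x y, (x = v ∨ x ∈ B) → (y = v ∨ y ∈ B) →
      (∀ z ∈ B, (z ∈ closedNbhd G x ↔ z ∈ closedNbhd G y)) → x = y)
    (hadj₀ : ∀ x, x ∉ B → ∃ z ∈ B, G.Adj x z)
    (hadj₁ : ∀ x, (x = v ∨ x ∈ B) → ∃ z, z ∉ B ∧ z ≠ v ∧ G.Adj x z)
    (hcross : ∀ x y, x ∈ B → y ∉ B → y ≠ v →
      (∃ z ∈ B, z ≠ x ∧ G.Adj y z) ∨ ∃ z, z ∉ B ∧ z ≠ v ∧ z ≠ y ∧ G.Adj x z) :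
    ∃ C, IsIDCode (prism G) C ∧ C.card = Nat.card V - 1 := by
  classical
  have := Fintype.ofFinite V
  let f : V → V × Fin 2 := fun x => (x, if x ∈ B then 1 else 0)
  have hf : Function.Injective f := fun x y h => congrArg Prod.fst h
  let C : Finset (V × Fin 2) := ({v}ᶜ : Finset V).image f
  have mem₀ : ∀ z, (z, (0 : Fin 2)) ∈ C ↔ z ∉ B ∧ z ≠ v := by
    intro z
    simp only [C, f, Finset.mem_image, Finset.mem_compl, Finset.mem_singleton, Prod.mk.injEq]
    constructor
    · rintro ⟨w, hw, rfl, h⟩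
      refine ⟨fun hB => ?_, hw⟩
      simp [hB] at h
    · rintro ⟨hB, hz⟩
      exact ⟨z, hz, rfl, by simp [hB]⟩
  have mem₁ : ∀ z, (z, (1 : Fin 2)) ∈ C ↔ z ∈ B := by
    intro z
    simp only [C, f, Finset.mem_image, Finset.mem_compl, Finset.mem_singleton, Prod.mk.injEq]
    constructor
    · rintro ⟨w, hw, rfl, h⟩
      by_contra hB
      simp [hB] at h
    · intro hB
      exact ⟨z, fun h => hvB (h ▸ hB), rfl, by simp [hB]⟩
  have i00 : ∀ x z, (z, (0 : Fin 2)) ∈ idSet (prism G) C (x, 0) ↔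
      z ∈ closedNbhd G x ∧ z ∉ B ∧ z ≠ v := by
    intro x z
    simp only [idSet, Set.mem_inter_iff, mem_closedNbhd_prism_same, Finset.mem_coe, mem₀]
  have i11 : ∀ x z, (z, (1 : Fin 2)) ∈ idSet (prism G) C (x, 1) ↔
      z ∈ closedNbhd G x ∧ z ∈ B := by
    intro x z
    simp only [idSet, Set.mem_inter_iff, mem_closedNbhd_prism_same, Finset.mem_coe, mem₁]
  have i01 : ∀ x z, (z, (1 : Fin 2)) ∈ idSet (prism G) C (x, 0) ↔ z = x ∧ z ∈ B := by
    intro x z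
    simp only [idSet, Set.mem_inter_iff, mem_closedNbhd_prism_ne (zero_ne_one' (Fin 2)),
      Finset.mem_coe, mem₁]
  have i10 : ∀ x z, (z, (0 : Fin 2)) ∈ idSet (prism G) C (x, 1) ↔
      z = x ∧ z ∉ B ∧ z ≠ v := by
    intro x z
    simp only [idSet, Set.mem_inter_iff, mem_closedNbhd_prism_ne (zero_ne_one' (Fin 2)).symm,
      Finset.mem_coe, mem₀]
  -- If the traces agree, x has at most y as code neighbour in layer 0 and y at most x in layer 1.
  -- The adjacency hypotheses then leave only x ∈ B with y outside B and different from v, which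
  -- `hcross` excludes.
  have cross : ∀ x y, idSet (prism G) C (x, 0) ≠ idSet (prism G) C (y, 1) := by
    intro x y he
    have e₀ : ∀ z, (z ∈ closedNbhd G x ∧ z ∉ B ∧ z ≠ v) ↔ (z = y ∧ z ∉ B ∧ z ≠ v) := by
      intro z
      rw [← i00, he, i10]
    have e₁ : ∀ z, (z = x ∧ z ∈ B) ↔ (z ∈ closedNbhd G y ∧ z ∈ B) := by
      intro z
      rw [← i01, he, i11]
    by_cases hy : y = v ∨ y ∈ B
    · by_cases hx : x = v ∨ x ∈ B
      · obtain ⟨z, hz, hzv, hxz⟩ := hadj₁ x hx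
        obtain ⟨rfl, -⟩ := (e₀ z).1 ⟨Or.inr hxz, hz, hzv⟩
        exact hy.elim hzv hz
      · push Not at hx
        obtain ⟨rfl, -⟩ := (e₀ x).1 ⟨self_mem_closedNbhd x, hx.2, hx.1⟩
        exact hy.elim hx.1 hx.2
    · push Not at hy
      obtain ⟨z, hz, hyz⟩ := hadj₀ y hy.2
      obtain ⟨rfl, -⟩ := (e₁ z).2 ⟨Or.inr hyz, hz⟩
      obtain ⟨w, hw, hwz, hyw⟩ | ⟨w, hw, hwv, hwy, hzw⟩ := hcross z y hz hy.2 hy.1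
      · exact hwz ((e₁ w).2 ⟨Or.inr hyw, hw⟩).1
      · exact hwy ((e₀ w).1 ⟨Or.inr hzw, hw, hwv⟩).1
  refine ⟨C, ⟨?_, ?_, ?_⟩, ?_⟩
  · obtain ⟨z, hz, -⟩ := hadj₀ v hvB
    exact ⟨_, (mem₁ z).2 hz⟩
  · rintro ⟨x, a⟩
    obtain rfl | rfl : a = 0 ∨ a = 1 := by omega
    · by_cases hx : x = v ∨ x ∈ B
      · obtain ⟨z, hz, hzv, hxz⟩ := hadj₁ x hx
        exact ⟨_, (i00 x z).2 ⟨Or.inr hxz, hz, hzv⟩⟩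
      · push Not at hx
        exact ⟨_, (i00 x x).2 ⟨self_mem_closedNbhd x, hx.2, hx.1⟩⟩
    · by_cases hx : x ∈ B
      · exact ⟨_, (i11 x x).2 ⟨self_mem_closedNbhd x, hx⟩⟩
      · obtain ⟨z, hz, hxz⟩ := hadj₀ x hx
        exact ⟨_, (i11 x z).2 ⟨Or.inr hxz, hz⟩⟩
  · rintro ⟨x, a⟩ ⟨y, b⟩ hne he
    obtain rfl | rfl : a = 0 ∨ a = 1 := by omega
    · obtain rfl | rfl : b = 0 ∨ b = 1 := by omega
      · refine hne (congrArg (·, 0) ?_)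
        -- For x ∈ B the vertex (x, 0) sees (x, 1), which no other vertex of layer 0 sees; only
        -- vertices outside B need `hsep₀`.
        by_cases hx : x ∈ B
        · exact ((i01 y x).1 (he ▸ (i01 x x).2 ⟨rfl, hx⟩)).1
        by_cases hy : y ∈ B
        · exact ((i01 x y).1 (he ▸ (i01 y y).2 ⟨rfl, hy⟩)).1.symm
        refine hsep₀ x y hx hy fun z hz hzv => ?_
        have h := Set.ext_iff.1 he (z, 0)
        simpa [i00, hz, hzv] using h
      · exact cross x y he
    · obtain rfl | rfl : b = 0 ∨ b = 1 := by omega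
      · exact cross y x he.symm
      · refine hne (congrArg (·, 1) ?_)
        by_cases hx : x = v ∨ x ∈ B
        · by_cases hy : y = v ∨ y ∈ B
          · refine hsep₁ x y hx hy fun z hz => ?_
            have h := Set.ext_iff.1 he (z, 1)
            simpa [i11, hz] using h
          · push Not at hy
            exact ((i10 x y).1 (he ▸ (i10 y y).2 ⟨rfl, hy.2, hy.1⟩)).1.symm
        · push Not at hx
          exact ((i10 y x).1 (he ▸ (i10 x x).2 ⟨rfl, hx.2, hx.1⟩)).1
  · rw [Finset.card_image_of_injective _ hf, Finset.card_compl, Finset.card_singleton,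
      Nat.card_eq_fintype_card]

/-- No vertex of `G` is universal. -/
def NoUniversal (G : SimpleGraph V) : Prop := ∀ x, ∃ z, z ∉ closedNbhd G x

lemma NoUniversal.of_iso (e : G ≃g H) (h : NoUniversal H) : NoUniversal G := by
  intro x
  obtain ⟨z, hz⟩ := h (e x)
  exact ⟨e.symm z, by rw [← mem_closedNbhd_iso e]; simpa using hz⟩

lemma Superfluous.of_iso (e : G ≃g H) {v : W} (h : Superfluous H v) :
    Superfluous G (e.symm v) := by
  intro x y hxy
  refine e.injective (h _ _ fun z hz => ?_)
  have := hxy (e.symm z) fun h => hz (e.symm.injective h)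
  rw [← mem_closedNbhd_iso e, ← mem_closedNbhd_iso e] at this
  simpa using this

lemma Superfluous.closedNbhd_injective {v : V} (h : Superfluous G v) {x y : V}
    (hxy : ∀ z, z ∈ closedNbhd G x ↔ z ∈ closedNbhd G y) : x = y :=
  h x y fun z _ => hxy z

/-- Vertices on opposite sides are told apart inside H: the left one sees all of H, the right one
does not. -/
lemma Superfluous.join {v : V} (h : Superfluous G v)
    (hH : ∀ x y, (∀ z, z ∈ closedNbhd H x ↔ z ∈ closedNbhd H y) → x = y)
    (hH' : NoUniversal H) : Superfluous (join G H) (Sum.inl v) := by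
  rintro (x | x) (y | y) hxy
  · exact congrArg _ (h x y fun z hz => by simpa using hxy (Sum.inl z) (by simpa using hz))
  · obtain ⟨z, hz⟩ := hH' y
    exact (hz (by simpa using hxy (Sum.inr z) (by simp))).elim
  · obtain ⟨z, hz⟩ := hH' x
    exact (hz (by simpa using hxy (Sum.inr z) (by simp))).elim
  · exact congrArg _ (hH x y fun z => by simpa using hxy (Sum.inr z) (by simp))

lemma noUniversal_graphA (k : ℕ) : NoUniversal (graphA k) := by
  intro x
  have hx := x.isLt
  by_cases h : (x : ℕ) < k
  · exact ⟨⟨x + k, by omega⟩, by simp [mem_closedNbhd_graphA]⟩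
  · exact ⟨⟨x - k, by omega⟩, by rw [mem_closedNbhd_graphA]; dsimp only; omega⟩

/-- For x < y, the index x + k (if x < k) is missed by x only, and y - k (if x ≥ k) by y only.
Neither index is 0, which makes 0 superfluous. -/
lemma graphA_ext {k : ℕ} {x y : Fin (2 * k)} (hlt : (x : ℕ) < y)
    (h : ∀ z : Fin (2 * k), (z : ℕ) ≠ 0 →
      (z ∈ closedNbhd (graphA k) x ↔ z ∈ closedNbhd (graphA k) y)) : False := by
  have hx := x.isLt
  have hy := y.isLt
  simp only [mem_closedNbhd_graphA] at h
  by_cases hxk : (x : ℕ) < k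
  · have := h ⟨x + k, by omega⟩ (by dsimp only; omega)
    dsimp only at this
    omega
  · have := h ⟨y - k, by omega⟩ (by dsimp only; omega)
    dsimp only at this
    omega

lemma superfluous_graphA {k : ℕ} (hk : 1 ≤ k) :
    Superfluous (graphA k) ⟨0, by omega⟩ := by
  intro x y h
  have h' : ∀ z : Fin (2 * k), (z : ℕ) ≠ 0 →
      (z ∈ closedNbhd (graphA k) x ↔ z ∈ closedNbhd (graphA k) y) :=
    fun z hz => h z fun he => hz (by rw [he])
  rcases lt_trichotomy (x : ℕ) y with hlt | heq | hlt
  · exact (graphA_ext hlt h').elim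
  · exact Fin.ext heq
  · exact (graphA_ext hlt fun z hz => (h' z hz).symm).elim

lemma ClassA.noUniversal (h : ClassA G) : NoUniversal G := by
  induction h with
  | base G k hk e => exact (noUniversal_graphA k).of_iso e.some
  | join G G₁ G₂ _ _ e ih₁ ih₂ =>
    refine NoUniversal.of_iso e.some ?_
    rintro (x | x)
    · obtain ⟨z, hz⟩ := ih₁ x
      exact ⟨Sum.inl z, by simpa using hz⟩
    · obtain ⟨z, hz⟩ := ih₂ x
      exact ⟨Sum.inr z, by simpa using hz⟩

lemma ClassA.exists_superfluous (h : ClassA G) : ∃ v, Superfluous G v := by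
  induction h with
  | base G k hk e => exact ⟨_, (superfluous_graphA hk).of_iso e.some⟩
  | join G G₁ G₂ h₁ h₂ e ih₁ ih₂ =>
    obtain ⟨v, hv⟩ := ih₁
    obtain ⟨w, hw⟩ := ih₂
    exact ⟨_, (hv.join (fun _ _ => hw.closedNbhd_injective) h₂.noUniversal).of_iso e.some⟩

lemma ClassA.nontrivial (h : ClassA G) : Nontrivial V := by
  obtain ⟨v, -⟩ := h.exists_superfluous
  obtain ⟨z, hz⟩ := h.noUniversal v
  exact ⟨z, v, fun h => hz (h ▸ self_mem_closedNbhd z)⟩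

lemma ClassA.exists_ne (h : ClassA G) (x : V) : ∃ z, z ≠ x :=
  have := h.nontrivial
  _root_.exists_ne x

lemma ClassA.finite (h : ClassA G) : Finite V := by
  induction h with
  | base G k hk e => exact Finite.of_equiv _ e.some.symm.toEquiv
  | join G G₁ G₂ h₁ h₂ e ih₁ ih₂ => exact Finite.of_equiv _ e.some.symm.toEquiv

lemma InClass.finite (h : InClass G) : Finite V := by
  rcases h with h | ⟨W, H, hH, ⟨e⟩⟩
  · exact h.finite
  · have := hH.finite
    exact Finite.of_equiv _ e.symm.toEquiv

/-- The only member of order 2 is the edgeless A₁; no other member has an isolated vertex. -/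
lemma ClassA.exists_adj (h : ClassA G) (hcard : Nat.card V ≠ 2) (v : V) : ∃ z, G.Adj v z := by
  cases h with
  | base _ k hk e =>
    obtain ⟨e⟩ := e
    have hk2 : k ≠ 1 := by
      rintro rfl
      exact hcard (by simp [Nat.card_congr e.toEquiv])
    have hv := (e v).isLt
    by_cases hlt : (e v : ℕ) + 1 < 2 * k
    · refine ⟨e.symm ⟨e v + 1, hlt⟩, ?_⟩
      rw [← e.map_adj_iff, graphA_adj]
      simp
      omega
    · refine ⟨e.symm ⟨e v - 1, by omega⟩, ?_⟩
      rw [← e.map_adj_iff, graphA_adj]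
      simp
      omega
  | join _ G₁ G₂ h₁ h₂ e =>
    obtain ⟨e⟩ := e
    have := h₁.nontrivial
    have := h₂.nontrivial
    have key : ∀ a, ∃ b, (IdentifyingCode.join G₁ G₂).Adj a b := by
      rintro (a | a)
      · exact ⟨Sum.inr (Classical.arbitrary _), by simp⟩
      · exact ⟨Sum.inl (Classical.arbitrary _), by simp⟩
    obtain ⟨b, hb⟩ := key (e v)
    exact ⟨e.symm b, by rw [← e.map_adj_iff]; simpa using hb⟩

/-- The vertex of K₁ is the only universal one, so it is recognised without its own help by what the
others miss in G. -/
lemma superfluous_join_one (h : ClassA G) :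
    Superfluous (join G (SimpleGraph.completeGraph (Fin 1))) (Sum.inr 0) := by
  obtain ⟨v, hv⟩ := h.exists_superfluous
  rintro (x | x) (y | y) hxy
  · exact congrArg _ (hv.closedNbhd_injective fun z => by
      simpa using hxy (Sum.inl z) (by simp))
  · obtain ⟨z, hz⟩ := h.noUniversal x
    exact (hz (by simpa using hxy (Sum.inl z) (by simp))).elim
  · obtain ⟨z, hz⟩ := h.noUniversal y
    exact (hz (by simpa using hxy (Sum.inl z) (by simp))).elim
  · rw [Subsingleton.elim x y]

lemma InClass.exists_isIDCode (h : InClass G) (hcard : 5 ≤ Nat.card V) :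
    ∃ C, IsIDCode G C ∧ C.card = Nat.card V - 1 := by
  have := h.finite
  rcases h with h | ⟨W, H, hH, ⟨e⟩⟩
  · obtain ⟨v, hv⟩ := h.exists_superfluous
    exact hv.exists_isIDCode (h.exists_adj (by omega) v)
  · have := hH.finite
    have := hH.nontrivial
    rw [Nat.card_congr e.toEquiv]
    exact exists_isIDCode_of_iso e ((superfluous_join_one hH).exists_isIDCode
      ⟨Sum.inl (Classical.arbitrary W), by simp⟩)

/-! ### Splitting the vertices between the layers, for each shape of graph. -/

lemma exists_isIDCode_prism_graphA {k : ℕ} (hk : 3 ≤ k) :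
    ∃ C, IsIDCode (prism (graphA k)) C ∧ C.card = Nat.card (Fin (2 * k)) - 1 := by
  have sep₀ : ∀ x y : Fin (2 * k), (x : ℕ) < y → (x : ℕ) ≠ k - 1 → (y : ℕ) ≠ k - 1 →
      (y : ℕ) ≠ 2 * k - 1 → ∃ z : Fin (2 * k), (z : ℕ) ≠ k - 1 ∧ (z : ℕ) ≠ 2 * k - 1 ∧
        (z : ℕ) ≠ 2 * k - 2 ∧ ¬ (z ∈ closedNbhd (graphA k) x ↔ z ∈ closedNbhd (graphA k) y) := by
    intro x y hlt hx hy hy'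
    have := y.isLt
    simp only [mem_closedNbhd_graphA]
    by_cases h₁ : (x : ℕ) < k - 2
    · exact ⟨⟨x + k, by omega⟩, by dsimp only; omega⟩
    -- Here x = k - 2, and x + k = 2k - 2 is the omitted vertex. Since y ≥ k, vertex 0 separates
    -- instead.
    by_cases h₂ : (x : ℕ) < k
    · exact ⟨⟨0, by omega⟩, by dsimp only; omega⟩
    · exact ⟨⟨y - k, by omega⟩, by dsimp only; omega⟩
  -- The traces on B = {k - 1, 2k - 1} are {k - 1} for k - 1, {2k - 1} for 2k - 1, and all of B for
  -- the omitted vertex 2k - 2.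
  refine exists_isIDCode_prism {i | (i : ℕ) = k - 1 ∨ (i : ℕ) = 2 * k - 1}
    ⟨2 * k - 2, by omega⟩ ?_ ?_ ?_ ?_ ?_ ?_ <;>
    simp only [Set.mem_ofPred_eq, Fin.ext_iff, not_or, ne_eq]
  · omega
  · intro x y hx hy h
    rcases lt_trichotomy (x : ℕ) y with hlt | heq | hlt
    · obtain ⟨z, h₁, h₂, h₃, h₄⟩ := sep₀ x y hlt hx.1 hy.1 hy.2
      exact (h₄ (h z ⟨h₁, h₂⟩ h₃)).elim
    · exact heq
    · obtain ⟨z, h₁, h₂, h₃, h₄⟩ := sep₀ y x hlt hy.1 hx.1 hx.2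
      exact (h₄ (h z ⟨h₁, h₂⟩ h₃).symm).elim
  · intro x y hx hy h
    have h₁ := h ⟨k - 1, by omega⟩ (by simp)
    have h₂ := h ⟨2 * k - 1, by omega⟩ (by simp)
    simp only [mem_closedNbhd_graphA] at h₁ h₂
    omega
  · intro x hx
    have := x.isLt
    simp only [graphA_adj]
    by_cases h : (x : ℕ) < k
    · exact ⟨⟨k - 1, by omega⟩, by dsimp only; omega⟩
    · exact ⟨⟨2 * k - 1, by omega⟩, by dsimp only; omega⟩
  · intro x hx
    simp only [graphA_adj]
    exact ⟨⟨k, by omega⟩, by dsimp only; omega⟩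
  · intro x y hx hy hyv
    have := y.isLt
    simp only [graphA_adj]
    rcases hx with hx | hx
    · right
      by_cases h : (y : ℕ) = k
      · exact ⟨⟨k - 2, by omega⟩, by dsimp only; omega⟩
      · exact ⟨⟨k, by omega⟩, by dsimp only; omega⟩
    · by_cases h : (y : ℕ) = k
      · exact Or.inl ⟨⟨k - 1, by omega⟩, by dsimp only; omega⟩
      · exact Or.inr ⟨⟨k, by omega⟩, by dsimp only; omega⟩

lemma exists_isIDCode_prism_graphA_join_one {k : ℕ} (hk : 2 ≤ k) :
    ∃ C, IsIDCode (prism (join (graphA k) (SimpleGraph.completeGraph (Fin 1)))) C ∧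
      C.card = Nat.card (Fin (2 * k) ⊕ Fin 1) - 1 := by
  have sep₀ : ∀ x y : Fin (2 * k), (x : ℕ) < y → (x : ℕ) ≠ k - 1 → (y : ℕ) ≠ k - 1 →
      (y : ℕ) ≠ 2 * k - 1 → ∃ z : Fin (2 * k), (z : ℕ) ≠ k - 1 ∧ (z : ℕ) ≠ 2 * k - 1 ∧
        ¬ (z ∈ closedNbhd (graphA k) x ↔ z ∈ closedNbhd (graphA k) y) := by
    intro x y hlt hx hy hy'
    have := y.isLt
    simp only [mem_closedNbhd_graphA]
    by_cases h₁ : (x : ℕ) < k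
    · exact ⟨⟨x + k, by omega⟩, by dsimp only; omega⟩
    · exact ⟨⟨y - k, by omega⟩, by dsimp only; omega⟩
  have nonuniv : ∀ x : Fin (2 * k), (x : ℕ) ≠ k - 1 → (x : ℕ) ≠ 2 * k - 1 →
      ∃ z : Fin (2 * k), (z : ℕ) ≠ k - 1 ∧ (z : ℕ) ≠ 2 * k - 1 ∧
        z ∉ closedNbhd (graphA k) x := by
    intro x hx hx'
    have := x.isLt
    simp only [mem_closedNbhd_graphA]
    by_cases h₁ : (x : ℕ) < k
    · exact ⟨⟨x + k, by omega⟩, by dsimp only; omega⟩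
    · exact ⟨⟨x - k, by omega⟩, by dsimp only; omega⟩
  let B : Set (Fin (2 * k) ⊕ Fin 1) := Sum.inl '' {i | (i : ℕ) = k - 1 ∨ (i : ℕ) = 2 * k - 1}
  have inl_mem : ∀ i, Sum.inl i ∈ B ↔ (i : ℕ) = k - 1 ∨ (i : ℕ) = 2 * k - 1 := by simp [B]
  have inr_mem : ∀ i, Sum.inr i ∉ B := by simp [B]
  clear_value B
  -- The K₁ vertex is omitted; it alone sees all of the remaining layer 0 or, among itself and B,
  -- both elements of B.
  refine exists_isIDCode_prism B (Sum.inr 0) (inr_mem 0) ?_ ?_ ?_ ?_ ?_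
  · rintro (x | x) (y | y) hx hy h
    · rw [inl_mem, not_or] at hx hy
      refine congrArg _ (Fin.ext ?_)
      rcases lt_trichotomy (x : ℕ) y with hlt | heq | hlt
      · obtain ⟨z, h₁, h₂, h₃⟩ := sep₀ x y hlt hx.1 hy.1 hy.2
        exact (h₃ (by simpa using h (Sum.inl z) (by simp [inl_mem, h₁, h₂]) (by simp))).elim
      · exact heq
      · obtain ⟨z, h₁, h₂, h₃⟩ := sep₀ y x hlt hy.1 hx.1 hx.2
        exact (h₃ (by simpa using (h (Sum.inl z) (by simp [inl_mem, h₁, h₂]) (by simp)).symm)).elim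
    · rw [inl_mem, not_or] at hx
      obtain ⟨z, h₁, h₂, h₃⟩ := nonuniv x hx.1 hx.2
      exact (h₃ (by simpa using h (Sum.inl z) (by simp [inl_mem, h₁, h₂]) (by simp))).elim
    · rw [inl_mem, not_or] at hy
      obtain ⟨z, h₁, h₂, h₃⟩ := nonuniv y hy.1 hy.2
      exact (h₃ (by simpa using h (Sum.inl z) (by simp [inl_mem, h₁, h₂]) (by simp))).elim
    · rw [Subsingleton.elim x y]
  · intro x y hx hy h
    have h₁ := h (Sum.inl ⟨k - 1, by omega⟩) (by simp [inl_mem])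
    have h₂ := h (Sum.inl ⟨2 * k - 1, by omega⟩) (by simp [inl_mem])
    rcases x with x | x <;> rcases y with y | y <;>
      simp only [inl_mem, inr_mem, reduceCtorEq, false_or, or_false,
        inl_mem_closedNbhd_join_inl, inl_mem_closedNbhd_join_inr, mem_closedNbhd_graphA,
        iff_true, true_iff] at *
    · exact congrArg _ (Fin.ext (by omega))
    · omega
    · omega
    · rw [Subsingleton.elim x y]
  · rintro (x | x) hx
    · rw [inl_mem] at hx
      have := x.isLt
      by_cases h : (x : ℕ) < k
      · exact ⟨Sum.inl ⟨k - 1, by omega⟩, by simp [inl_mem],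
          by rw [join_adj_inl_inl, graphA_adj]; dsimp only; omega⟩
      · exact ⟨Sum.inl ⟨2 * k - 1, by omega⟩, by simp [inl_mem],
          by rw [join_adj_inl_inl, graphA_adj]; dsimp only; omega⟩
    · exact ⟨Sum.inl ⟨k - 1, by omega⟩, by simp [inl_mem], by simp⟩
  · rintro (x | x) hx
    · have hx : (x : ℕ) = k - 1 ∨ (x : ℕ) = 2 * k - 1 := by simpa [inl_mem] using hx
      exact ⟨Sum.inl ⟨k, by omega⟩, by rw [inl_mem]; dsimp only; omega, by simp,
        by rw [join_adj_inl_inl, graphA_adj]; dsimp only; omega⟩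
    · exact ⟨Sum.inl ⟨k, by omega⟩, by rw [inl_mem]; dsimp only; omega, by simp, by simp⟩
  · rintro (x | x) (y | y) hx hy hyv
    · rw [inl_mem] at hx hy
      have := y.isLt
      by_cases h : (y : ℕ) < k
      · by_cases hxk : (x : ℕ) = k - 1
        · exact Or.inr ⟨Sum.inl ⟨k, by omega⟩, by rw [inl_mem]; dsimp only; omega, by simp,
            by rw [ne_eq, Sum.inl.injEq, Fin.ext_iff]; dsimp only; omega,
            by rw [join_adj_inl_inl, graphA_adj]; dsimp only; omega⟩
        · exact Or.inl ⟨Sum.inl ⟨k - 1, by omega⟩, by simp [inl_mem],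
            by rw [ne_eq, Sum.inl.injEq, Fin.ext_iff]; dsimp only; omega,
            by rw [join_adj_inl_inl, graphA_adj]; dsimp only; omega⟩
      · left
        by_cases hxk : (x : ℕ) = k - 1
        · exact ⟨Sum.inl ⟨2 * k - 1, by omega⟩, by simp [inl_mem],
            by rw [ne_eq, Sum.inl.injEq, Fin.ext_iff]; dsimp only; omega,
            by rw [join_adj_inl_inl, graphA_adj]; dsimp only; omega⟩
        · exact ⟨Sum.inl ⟨k - 1, by omega⟩, by simp [inl_mem],
            by rw [ne_eq, Sum.inl.injEq, Fin.ext_iff]; dsimp only; omega,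
            by rw [join_adj_inl_inl, graphA_adj]; dsimp only; omega⟩
    · exact (hyv (by rw [Subsingleton.elim y 0])).elim
    · exact (inr_mem x hx).elim
    · exact (inr_mem x hx).elim

/-- The join of two members of the class, the left one with more than two vertices. -/
lemma exists_isIDCode_prism_join (hG : ClassA G) (hH : ClassA H) (hcard : Nat.card V ≠ 2) :
    ∃ C, IsIDCode (prism (join G H)) C ∧ C.card = Nat.card (V ⊕ W) - 1 := by
  have := hG.finite
  have := hH.finite
  have hW := hH.nontrivial
  obtain ⟨v, hv⟩ := hG.exists_superfluous
  obtain ⟨a, ha⟩ := hG.exists_ne v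
  obtain ⟨w⟩ := hW.to_nonempty
  obtain ⟨w', hw'⟩ := hH.exists_superfluous
  -- H fills layer 1, and G minus its superfluous vertex fills layer 0. The order condition on G
  -- gives v a neighbour in layer 0.
  refine exists_isIDCode_prism (Set.range Sum.inr) (Sum.inl v) ?_ ?_ ?_ ?_ ?_ ?_
  · simp
  · rintro (x | x) (y | y) hx hy h
    · exact congrArg _ (hv x y fun z hz => by
        simpa using h (Sum.inl z) (by simp) (by simpa using hz))
    all_goals simp at hx hy
  · rintro (x | x) (y | y) hx hy h
    · simp only [Sum.inl.injEq, Set.mem_range, reduceCtorEq, exists_false, or_false] at hx hy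
      rw [hx, hy]
    · obtain ⟨z, hz⟩ := hH.noUniversal y
      exact (hz (by simpa using h (Sum.inr z) (by simp))).elim
    · obtain ⟨z, hz⟩ := hH.noUniversal x
      exact (hz (by simpa using h (Sum.inr z) (by simp))).elim
    · exact congrArg _ (hw'.closedNbhd_injective fun z => by
        simpa using h (Sum.inr z) (by simp))
  · rintro (x | x) hx
    · exact ⟨Sum.inr w, by simp⟩
    · simp at hx
  · rintro (x | x) hx
    · simp only [Sum.inl.injEq, Set.mem_range, reduceCtorEq, exists_false, or_false] at hx
      obtain ⟨z, hz⟩ := hG.exists_adj hcard x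
      exact ⟨Sum.inl z, by simp, by simpa [← hx] using hz.ne', by simpa using hz⟩
    · exact ⟨Sum.inl a, by simp, by simpa using ha, by simp⟩
  · rintro (x | x) (y | y) hx hy hyv
    · simp at hx
    · simp at hx
    · obtain ⟨z, hz⟩ := hH.exists_ne x
      exact Or.inl ⟨Sum.inr z, by simp, by simpa using hz, by simp⟩
    · simp at hy

/-- The isomorphism interchanging the two sides of a join. -/
def joinComm (G : SimpleGraph V) (H : SimpleGraph W) : join G H ≃g join H G where
  toEquiv := Equiv.sumComm V W
  map_rel_iff' := by rintro (x | x) (y | y) <;> simp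

/-- Joining the left sides of an isomorphism with a common right side. -/
def joinIsoLeft {V' : Type w} {G' : SimpleGraph V'} (e : G ≃g G') (H : SimpleGraph W) :
    join G H ≃g join G' H where
  toEquiv := e.toEquiv.sumCongr (Equiv.refl W)
  map_rel_iff' := by rintro (x | x) (y | y) <;> simp [e.map_adj_iff]

lemma exists_isIDCode_prism_join_join_one (hG : ClassA G) (hH : ClassA H) :
    ∃ C, IsIDCode (prism (join (join G H) (SimpleGraph.completeGraph (Fin 1)))) C ∧
      C.card = Nat.card ((V ⊕ W) ⊕ Fin 1) - 1 := by
  have := hG.finite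
  have := hH.finite
  obtain ⟨v⟩ := hG.nontrivial.to_nonempty
  obtain ⟨w⟩ := hH.nontrivial.to_nonempty
  obtain ⟨v', hv⟩ := hG.exists_superfluous
  obtain ⟨w', hw⟩ := hH.exists_superfluous
  -- G fills layer 0 and H layer 1; the omitted K₁ vertex sees all of each, which no vertex of G or
  -- H does on its own side.
  refine exists_isIDCode_prism (Set.range (Sum.inl ∘ Sum.inr)) (Sum.inr 0) ?_ ?_ ?_ ?_ ?_ ?_
  · simp
  · rintro ((x | x) | x) ((y | y) | y) hx hy h
    · exact congrArg (Sum.inl ∘ Sum.inl) (hv.closedNbhd_injective fun z => by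
        simpa using h (Sum.inl (Sum.inl z)) (by simp) (by simp))
    · simp at hy
    · obtain ⟨z, hz⟩ := hG.noUniversal x
      exact (hz (by simpa using h (Sum.inl (Sum.inl z)) (by simp) (by simp))).elim
    · simp at hx
    · simp at hx
    · simp at hx
    · obtain ⟨z, hz⟩ := hG.noUniversal y
      exact (hz (by simpa using h (Sum.inl (Sum.inl z)) (by simp) (by simp))).elim
    · simp at hy
    · rw [Subsingleton.elim x y]
  · rintro ((x | x) | x) ((y | y) | y) hx hy h
    · simp at hx
    · simp at hx
    · simp at hx
    · simp at hy
    · exact congrArg (Sum.inl ∘ Sum.inr) (hw.closedNbhd_injective fun z => by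
        simpa using h (Sum.inl (Sum.inr z)) (by simp))
    · obtain ⟨z, hz⟩ := hH.noUniversal x
      exact (hz (by simpa using h (Sum.inl (Sum.inr z)) (by simp))).elim
    · simp at hy
    · obtain ⟨z, hz⟩ := hH.noUniversal y
      exact (hz (by simpa using h (Sum.inl (Sum.inr z)) (by simp))).elim
    · rw [Subsingleton.elim x y]
  · rintro ((x | x) | x) hx
    · exact ⟨Sum.inl (Sum.inr w), by simp⟩
    · simp at hx
    · exact ⟨Sum.inl (Sum.inr w), by simp⟩
  · rintro ((x | x) | x) hx
    · simp at hx
    · exact ⟨Sum.inl (Sum.inl v), by simp⟩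
    · exact ⟨Sum.inl (Sum.inl v), by simp⟩
  · rintro x ((y | y) | y) hx hy hyv
    · obtain ⟨x, rfl⟩ := hx
      obtain ⟨z, hz⟩ := hH.exists_ne x
      exact Or.inl ⟨Sum.inl (Sum.inr z), by simp, by simpa using hz, by simp⟩
    · simp at hy
    · exact (hyv (by rw [Subsingleton.elim y 0])).elim

lemma ClassA.exists_isIDCode_prism (h : ClassA G) (hcard : 5 ≤ Nat.card V) :
    ∃ C, IsIDCode (prism G) C ∧ C.card = Nat.card V - 1 := by
  cases h with
  | base _ k hk e =>
    obtain ⟨e⟩ := e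
    rw [Nat.card_congr e.toEquiv] at hcard ⊢
    exact exists_isIDCode_of_iso (prismIso e)
      (exists_isIDCode_prism_graphA (by rw [Nat.card_fin] at hcard; omega))
  | @join _ V₁ V₂ _ G₁ G₂ h₁ h₂ e =>
    obtain ⟨e⟩ := e
    have := h₁.finite
    have := h₂.finite
    rw [Nat.card_congr e.toEquiv] at hcard ⊢
    rw [Nat.card_sum] at hcard
    -- If the left factor has order 2, the factors are swapped: total order at least 5 makes the
    -- other one larger.
    by_cases hc : Nat.card V₁ = 2
    · refine exists_isIDCode_of_iso (prismIso (e.trans (joinComm G₁ G₂))) ?_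
      rw [Nat.card_congr (Equiv.sumComm _ _)]
      exact exists_isIDCode_prism_join h₂ h₁ (fun h => by omega)
    · exact exists_isIDCode_of_iso (prismIso e) (exists_isIDCode_prism_join h₁ h₂ hc)

lemma InClass.exists_isIDCode_prism (h : InClass G) (hcard : 5 ≤ Nat.card V) :
    ∃ C, IsIDCode (prism G) C ∧ C.card = Nat.card V - 1 := by
  rcases h with h | ⟨W, H, hH, ⟨e⟩⟩
  · exact h.exists_isIDCode_prism hcard
  · rw [Nat.card_congr e.toEquiv] at hcard ⊢
    refine exists_isIDCode_of_iso (prismIso e) ?_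
    cases hH with
    | base _ k hk e' =>
      obtain ⟨e'⟩ := e'
      rw [Nat.card_congr (joinIsoLeft e' (SimpleGraph.completeGraph (Fin 1))).toEquiv] at hcard ⊢
      refine exists_isIDCode_of_iso (prismIso (joinIsoLeft e' _))
        (exists_isIDCode_prism_graphA_join_one ?_)
      rw [Nat.card_sum, Nat.card_fin, Nat.card_fin] at hcard
      omega
    | join _ G₁ G₂ h₁ h₂ e' =>
      obtain ⟨e'⟩ := e'
      rw [Nat.card_congr (joinIsoLeft e' (SimpleGraph.completeGraph (Fin 1))).toEquiv]
      exact exists_isIDCode_of_iso (prismIso (joinIsoLeft e' _))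
        (exists_isIDCode_prism_join_join_one h₁ h₂)

end UpperBound

/-! ### The common value, order minus one, and its consequences. -/

section Main

variable {V : Type u} {G : SimpleGraph V}

lemma InClass.idNumber_eq (h : InClass G) (hcard : 5 ≤ Nat.card V) :
    idNumber G = Nat.card V - 1 :=
  have := h.finite
  IdentifyingCode.idNumber_eq (h.exists_isIDCode hcard)
    fun _ => h.hasCharge.le_card_of_isIDCode

lemma InClass.idNumber_prism_eq (h : InClass G) (hcard : 5 ≤ Nat.card V) :
    idNumber (prism G) = Nat.card V - 1 :=
  have := h.finite
  IdentifyingCode.idNumber_eq (h.exists_isIDCode_prism hcard)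
    fun _ => h.hasCharge.le_card_of_isIDCode_prism

lemma InClass.hasIDCode (h : InClass G) (hcard : 5 ≤ Nat.card V) : HasIDCode G :=
  (h.exists_isIDCode hcard).imp fun _ hC => hC.1

lemma InClass.hasIDCode_prism (h : InClass G) (hcard : 5 ≤ Nat.card V) :
    HasIDCode (prism G) :=
  (h.exists_isIDCode_prism hcard).imp fun _ hC => hC.1

lemma exists_inClass_fin {n : ℕ} (hn : 2 ≤ n) : ∃ G : SimpleGraph (Fin n), InClass G := by
  have hbase : ∀ k, 1 ≤ k → ClassA (graphA k) := fun k hk => .base _ k hk ⟨SimpleGraph.Iso.refl⟩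
  obtain ⟨m, rfl | rfl⟩ := Nat.even_or_odd' n
  · exact ⟨graphA m, Or.inl (hbase m (by omega))⟩
  · exact ⟨_, Or.inr ⟨_, graphA m, hbase m (by omega),
      ⟨(SimpleGraph.Iso.map finSumFinEquiv _).symm⟩⟩⟩

end Main

end IdentifyingCode

open IdentifyingCode
theorem theorem4p5 :
    -- every member of the class of order at least 5 has the same ID code number as its prism
    (∀ {V : Type*} (G : SimpleGraph V), IdentifyingCode.InClass G → 5 ≤ Nat.card V →
      IdentifyingCode.HasIDCode G ∧
      IdentifyingCode.HasIDCode (IdentifyingCode.prism G) ∧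
      IdentifyingCode.idNumber (IdentifyingCode.prism G) = IdentifyingCode.idNumber G) ∧
    -- every value `k ≥ 4` of the common number occurs in this way
    (∀ k : ℕ, 4 ≤ k → ∃ (n : ℕ) (G : SimpleGraph (Fin n)),
      IdentifyingCode.InClass G ∧ 5 ≤ n ∧
      IdentifyingCode.HasIDCode G ∧
      IdentifyingCode.HasIDCode (IdentifyingCode.prism G) ∧
      IdentifyingCode.idNumber G = k ∧
      IdentifyingCode.idNumber (IdentifyingCode.prism G) = k) ∧
    -- joins
    (∀ {V₁ : Type*} {V₂ : Type*} (G₁ : SimpleGraph V₁) (G₂ : SimpleGraph V₂),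
      IdentifyingCode.InClass G₁ → IdentifyingCode.InClass G₂ →
      IdentifyingCode.InClass (IdentifyingCode.join G₁ G₂) →
      5 ≤ Nat.card V₁ → 5 ≤ Nat.card V₂ →
      IdentifyingCode.HasIDCode (IdentifyingCode.prism G₁) ∧
      IdentifyingCode.HasIDCode (IdentifyingCode.prism G₂) ∧
      IdentifyingCode.HasIDCode (IdentifyingCode.prism (IdentifyingCode.join G₁ G₂)) ∧
      IdentifyingCode.idNumber (IdentifyingCode.prism (IdentifyingCode.join G₁ G₂)) =
        IdentifyingCode.idNumber (IdentifyingCode.prism G₁) +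
          IdentifyingCode.idNumber (IdentifyingCode.prism G₂) + 1) := by
  refine ⟨fun G h hcard => ⟨h.hasIDCode hcard, h.hasIDCode_prism hcard, ?_⟩, fun k hk => ?_,
    fun {V₁ V₂} G₁ G₂ h₁ h₂ h hc₁ hc₂ => ?_⟩
  · rw [h.idNumber_eq hcard, h.idNumber_prism_eq hcard]
  · obtain ⟨G, hG⟩ := exists_inClass_fin (n := k + 1) (by omega)
    have hcard : 5 ≤ Nat.card (Fin (k + 1)) := by rw [Nat.card_fin]; omega
    refine ⟨k + 1, G, hG, by omega, hG.hasIDCode hcard, hG.hasIDCode_prism hcard, ?_, ?_⟩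
    · rw [hG.idNumber_eq hcard, Nat.card_fin, Nat.add_sub_cancel]
    · rw [hG.idNumber_prism_eq hcard, Nat.card_fin, Nat.add_sub_cancel]
  · have := h₁.finite
    have := h₂.finite
    have hcard : Nat.card (V₁ ⊕ V₂) = Nat.card V₁ + Nat.card V₂ := Nat.card_sum
    refine ⟨h₁.hasIDCode_prism hc₁, h₂.hasIDCode_prism hc₂, h.hasIDCode_prism (by omega), ?_⟩
    rw [h.idNumber_prism_eq (by omega), h₁.idNumber_prism_eq hc₁, h₂.idNumber_prism_eq hc₂]
    omega
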